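/- A measure $\lambda$ on a $\sigma$-algebra $\Sigma$ of subsets of a topological space $Z$ is *$\tau$-additive* if $\lambda(\bigcup\mathcal G)=\sup_{G\in\mathcal G}\lambda(G)$ for every non-empty upwards directed family $\mathcal G\subseteq\Sigma$ of open sets with $\bigcup\mathcal G\in\Sigma$. It is *topological* if $\Sigma$ contains all Borel sets. It is *effectively locally finite* if for every $E\in\Sigma$ with $\lambda(E)>0$ there is an open $G\in\Sigma$ with $\lambda(G)<\infty$ and $\lambda(E\cap G)>0$. It is *locally determined* if every $E\in\Sigma$ of infinite measure contains some $F\in\Sigma$ with $0<\lambda(F)<\infty$, and every $E\subseteq Z$ such that $E\cap F\in\Sigma$ for all $F\in\Sigma$ of finite measure belongs to $\Sigma$. It is *inner regular with respect to the Borel sets* if $\lambda(E)=\sup\{\lambda(B): B\subseteq E,\ B\in\Sigma \text{ Borel}\}$ for every $E\in\Sigma$. Let $X$ and $Y$ be regular topological spaces (not necessarily Hausdorff), and let $\mu$ and $\nu$ be $\tau$-additive Borel probability measures on $X$ and $Y$ respectively. There is a unique complete, locally determined, effectively locally finite, $\tau$-additive topological measure $\mu\times\nu$ on $X\times Y$ (with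 the product topology), inner regular with respect to the Borel sets, such that $(\mu\times\nu)(U\times V)=\mu(U)\,\nu(V)$ for all open $U\subseteq X$ and $V\subseteq Y$; uniqueness includes its $\sigma$-algebra. For every Borel set $W\subseteq X\times Y$, with $W_x=\{y\in Y:(x,y)\in W\}$ and $W^y=\{x\in X:(x,y)\in W\}$, the functions $x\mapsto\nu(W_x)$ and $y\mapsto\mu(W^y)$ are Borel measurable, and $$(\mu\times\nu)(W)=\int_X\nu(W_x)\,d\mu(x)=\int_Y\mu(W^y)\,d\nu(y).$$ -/

import Mathlib

open MeasureTheory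
open scoped ENNReal

/-- A measure on a topological space is `τ`-additive if, for every nonempty upwards directed family
`𝒢` of measurable open sets with measurable union, the measure of the union is the supremum of
the measures of the members. -/
def IsTauAdditive {Z : Type*} [TopologicalSpace Z] {m : MeasurableSpace Z}
    (lam : Measure Z) : Prop :=
  ∀ 𝒢 : Set (Set Z), 𝒢.Nonempty → DirectedOn (· ⊆ ·) 𝒢 →
    (∀ G ∈ 𝒢, IsOpen G) → (∀ G ∈ 𝒢, MeasurableSet G) → MeasurableSet (⋃₀ 𝒢) →
    lam (⋃₀ 𝒢) = ⨆ G ∈ 𝒢, lam G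

/-- A measure is effectively locally finite if every non-negligible measurable set meets some
measurable open set of finite measure in a non-negligible set. -/
def IsEffectivelyLocallyFinite {Z : Type*} [TopologicalSpace Z] {m : MeasurableSpace Z}
    (lam : Measure Z) : Prop :=
  ∀ E : Set Z, MeasurableSet E → 0 < lam E →
    ∃ G : Set Z, IsOpen G ∧ MeasurableSet G ∧ lam G < ∞ ∧ 0 < lam (E ∩ G)

/-- A measure is locally determined if it is semi-finite and every set whose intersections with
all measurable sets of finite measure are measurable is itself measurable. -/
structure IsLocallyDetermined {Z : Type*} {m : MeasurableSpace Z} (lam : Measure Z) : Prop where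
  semifinite : ∀ E : Set Z, MeasurableSet E → lam E = ∞ →
    ∃ F : Set Z, F ⊆ E ∧ MeasurableSet F ∧ 0 < lam F ∧ lam F < ∞
  measurableSet_of_inter : ∀ E : Set Z,
    (∀ F : Set Z, MeasurableSet F → lam F < ∞ → MeasurableSet (E ∩ F)) → MeasurableSet E

/-- `lam`, a measure on a `σ`-algebra `m` of subsets of `X × Y`, is the `τ`-additive product of
`μ` and `ν`. Note that `m` is arbitrary here: it is neither the product `σ`-algebra nor the Borel
`σ`-algebra in general, but the `σ`-algebra of a complete measure containing the Borel sets. -/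
structure IsTauProduct {X Y : Type*} [TopologicalSpace X] [MeasurableSpace X]
    [TopologicalSpace Y] [MeasurableSpace Y] (μ : Measure X) (ν : Measure Y)
    {m : MeasurableSpace (X × Y)} (lam : @Measure (X × Y) m) : Prop where
  topological : borel (X × Y) ≤ m
  complete : @Measure.IsComplete (X × Y) m lam
  locallyDetermined : @IsLocallyDetermined (X × Y) m lam
  effectivelyLocallyFinite : @IsEffectivelyLocallyFinite (X × Y) _ m lam
  tauAdditive : @IsTauAdditive (X × Y) _ m lam
  innerRegular_borel : @Measure.InnerRegularWRT (X × Y) m lam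
    (fun B => MeasurableSet[borel (X × Y)] B) (fun E => MeasurableSet[m] E)
  rectangle : ∀ (U : Set X) (V : Set Y), IsOpen U → IsOpen V → lam (U ×ˢ V) = μ U * ν V

/-! ### Countable reductions for `τ`-additive measures. -/

section TauAdditive

/-! Existence: put `W ↦ ∫ ν(W_x) dμ` on the Borel sets and complete it. For open `W`, `τ`-additivity
of `ν` makes `x ↦ ν(W_x)` lower semicontinuous, and a π-λ argument extends measurability to all
Borel `W`. This measure is `τ`-additive (`isTauAdditive_sectionMeasure`) because `τ`-additivity of
`μ`, applied to rational superlevel sets, replaces a directed family by a countable one.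

Uniqueness: open sets are directed unions of open sets from the σ-algebra generated by open
rectangles, so a finite `τ`-additive Borel measure is fixed by its values on rectangles
(`IsTauAdditive.ext_of_prod`). Inner regularity and completeness then fix the σ-algebra. Both
iterated integrals define `τ`-additive measures with the same values on rectangles, hence both equal
the product. -/

theorem DirectedOn.exists_accumulate_subset {Z : Type*} {𝒢 : Set (Set Z)}
    (hdir : DirectedOn (· ⊆ ·) 𝒢) {f : ℕ → Set Z} (hf : ∀ n, f n ∈ 𝒢) (n : ℕ) :
    ∃ G ∈ 𝒢, Set.accumulate f n ⊆ G := by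
  induction n with
  | zero => exact ⟨f 0, hf 0, by simp [Set.accumulate_def]⟩
  | succ n ih =>
    obtain ⟨G, hG, hsub⟩ := ih
    obtain ⟨H, hH, hGH, hfH⟩ := hdir G hG _ (hf (n + 1))
    refine ⟨H, hH, ?_⟩
    rw [Set.accumulate_succ]
    exact Set.union_subset (hsub.trans hGH) hfH

theorem DirectedOn.image_of_monotone {Z Z' : Type*} {𝒢 : Set (Set Z)}
    (hdir : DirectedOn (· ⊆ ·) 𝒢) {f : Set Z → Set Z'} (hf : Monotone f) :
    DirectedOn (· ⊆ ·) (f '' 𝒢) :=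
  directedOn_image.2 (hdir.mono fun _ _ h => hf h)

variable {Z : Type*} [TopologicalSpace Z]

/-- For a `τ`-additive measure, the measure of a directed union of open sets is already attained on
a countable subfamily. -/
theorem IsTauAdditive.exists_countable_measure_sUnion_image_eq {Z' : Type*}
    {m : MeasurableSpace Z} [OpensMeasurableSpace Z] {lam : Measure Z} (h : IsTauAdditive lam)
    {𝒢 : Set (Set Z')} (hne : 𝒢.Nonempty) (hdir : DirectedOn (· ⊆ ·) 𝒢) {f : Set Z' → Set Z}
    (hf : Monotone f) (hopen : ∀ G ∈ 𝒢, IsOpen (f G)) :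
    ∃ C ⊆ 𝒢, C.Countable ∧ lam (⋃₀ (f '' C)) = lam (⋃₀ (f '' 𝒢)) := by
  have hopen' : ∀ V ∈ f '' 𝒢, IsOpen V := Set.forall_mem_image.2 hopen
  obtain ⟨u, -, hu, hmem⟩ :=
    exists_seq_tendsto_sSup ((hne.image f).image lam) (OrderTop.bddAbove _)
  rw [Set.image_image] at hmem
  choose G hG hGu using hmem
  have hC : Set.range G ⊆ 𝒢 := Set.range_subset_iff.2 hG
  refine ⟨Set.range G, hC, Set.countable_range G, le_antisymm
    (measure_mono (Set.sUnion_subset_sUnion (Set.image_mono hC))) ?_⟩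
  rw [h _ (hne.image f) (hdir.image_of_monotone hf) hopen'
    (fun V hV => (hopen' V hV).measurableSet) (isOpen_sUnion hopen').measurableSet, ← sSup_image]
  refine le_of_tendsto' hu fun n => ?_
  rw [← hGu n]
  exact measure_mono (Set.subset_sUnion_of_mem ⟨_, ⟨n, rfl⟩, rfl⟩)

/-- A measure is `τ`-additive as soon as directed unions of open sets are covered, up to a
negligible set, by countable subfamilies. -/
theorem IsTauAdditive.of_exists_countable {m : MeasurableSpace Z} {lam : Measure Z}
    (h : ∀ 𝒢 : Set (Set Z), 𝒢.Nonempty → DirectedOn (· ⊆ ·) 𝒢 → (∀ G ∈ 𝒢, IsOpen G) →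
      ∃ C ⊆ 𝒢, C.Countable ∧ lam (⋃₀ 𝒢) ≤ lam (⋃₀ C)) : IsTauAdditive lam := by
  intro 𝒢 hne hdir hopen _ _
  refine le_antisymm ?_ (iSup₂_le fun G hG => measure_mono (Set.subset_sUnion_of_mem hG))
  obtain ⟨C, hC, hcount, hle⟩ := h 𝒢 hne hdir hopen
  refine hle.trans ?_
  rcases C.eq_empty_or_nonempty with rfl | hCne
  · simp
  obtain ⟨f, rfl⟩ := hcount.exists_eq_range hCne
  -- The finite partial unions need not lie in `𝒢`, but by directedness each is contained in a
  -- member.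
  rw [Set.sUnion_range, measure_iUnion_eq_iSup_accumulate]
  refine iSup_le fun n => ?_
  obtain ⟨G, hG, hsub⟩ := hdir.exists_accumulate_subset (fun n => hC ⟨n, rfl⟩) n
  exact (measure_mono hsub).trans (le_iSup₂ (f := fun G (_ : G ∈ 𝒢) => lam G) G hG)

theorem isTauAdditive_map {m : MeasurableSpace Z} [OpensMeasurableSpace Z] {lam : Measure Z}
    (h : IsTauAdditive lam) {Z' : Type*} [TopologicalSpace Z'] [MeasurableSpace Z']
    [BorelSpace Z'] {f : Z → Z'} (hf : Continuous f) : IsTauAdditive (lam.map f) := by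
  refine IsTauAdditive.of_exists_countable fun 𝒢 hne hdir hopen => ?_
  obtain ⟨C, hC, hCc, hCeq⟩ := h.exists_countable_measure_sUnion_image_eq hne hdir
    (f := (f ⁻¹' ·)) (fun _ _ h => Set.preimage_mono h) fun G hG => (hopen G hG).preimage hf
  refine ⟨C, hC, hCc, ?_⟩
  rw [Measure.map_apply hf.measurable (isOpen_sUnion hopen).measurableSet,
    Measure.map_apply hf.measurable (isOpen_sUnion fun G hG => hopen G (hC hG)).measurableSet,
    Set.preimage_sUnion, Set.preimage_sUnion, ← Set.sUnion_image, ← Set.sUnion_image]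
  exact hCeq.ge

end TauAdditive

/-! ### Sections and the iterated integral. -/

section Sections

variable {X Y : Type*} [TopologicalSpace X] [TopologicalSpace Y]
  [MeasurableSpace Y] [BorelSpace Y]

/-- The measure of the sections of an open set is lower semicontinuous. -/
theorem IsTauAdditive.lowerSemicontinuous_section {ν : Measure Y} (hν : IsTauAdditive ν)
    {W : Set (X × Y)} (hW : IsOpen W) :
    LowerSemicontinuous fun x => ν (Prod.mk x ⁻¹' W) := by
  intro x r hr
  -- Each `V` lies in every section over a whole neighbourhood of `x`, so a lower bound on `ν V`
  -- persists there.
  let 𝒢 : Set (Set Y) := {V | IsOpen V ∧ ∃ U : Set X, IsOpen U ∧ x ∈ U ∧ U ×ˢ V ⊆ W}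
  have hopen : ∀ V ∈ 𝒢, IsOpen V := fun V hV => hV.1
  have hunion : ⋃₀ 𝒢 = Prod.mk x ⁻¹' W := by
    ext y
    constructor
    · rintro ⟨V, ⟨-, U, -, hxU, hsub⟩, hy⟩
      exact hsub ⟨hxU, hy⟩
    · intro hy
      obtain ⟨U, V, hU, hV, hxU, hyV, hsub⟩ := isOpen_prod_iff.1 hW x y hy
      exact ⟨V, ⟨hV, U, hU, hxU, hsub⟩, hyV⟩
  have hdir : DirectedOn (· ⊆ ·) 𝒢 := by
    rintro V₁ ⟨hV₁, U₁, hU₁, hx₁, hs₁⟩ V₂ ⟨hV₂, U₂, hU₂, hx₂, hs₂⟩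
    refine ⟨V₁ ∪ V₂, ⟨hV₁.union hV₂, U₁ ∩ U₂, hU₁.inter hU₂, ⟨hx₁, hx₂⟩, ?_⟩,
      Set.subset_union_left, Set.subset_union_right⟩
    rintro ⟨a, b⟩ ⟨⟨ha₁, ha₂⟩, hb | hb⟩
    · exact hs₁ ⟨ha₁, hb⟩
    · exact hs₂ ⟨ha₂, hb⟩
  have hsup := hν 𝒢 ⟨∅, isOpen_empty, Set.univ, isOpen_univ, trivial, by simp⟩ hdir hopen
    (fun V hV => hV.1.measurableSet) (isOpen_sUnion hopen).measurableSet
  rw [hunion] at hsup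
  dsimp only at hr
  rw [hsup] at hr
  simp only [lt_iSup_iff] at hr
  obtain ⟨V, ⟨-, U, hU, hxU, hsub⟩, hlt⟩ := hr
  filter_upwards [hU.mem_nhds hxU] with x' hx'
  exact hlt.trans_le (measure_mono fun y hy => hsub ⟨hx', hy⟩)

variable [mXY : MeasurableSpace (X × Y)] [BorelSpace (X × Y)]

theorem measurable_prodMk_of_borelSpace (x : X) : Measurable (Prod.mk x : Y → X × Y) :=
  Continuous.measurable (by fun_prop)

variable [MeasurableSpace X] [BorelSpace X]

theorem IsTauAdditive.measurable_map_prodMk {ν : Measure Y} [IsProbabilityMeasure ν]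
    (hν : IsTauAdditive ν) : Measurable fun x : X => ν.map (Prod.mk x : Y → X × Y) := by
  have : ∀ x : X, IsProbabilityMeasure (ν.map (Prod.mk x : Y → X × Y)) := fun x =>
    Measure.isProbabilityMeasure_map (measurable_prodMk_of_borelSpace x).aemeasurable
  refine Measurable.measure_of_isPiSystem_of_isProbabilityMeasure
    (BorelSpace.measurable_eq (α := X × Y)) isPiSystem_isOpen fun W hW => ?_
  have hW : IsOpen W := hW
  simp only [Measure.map_apply (measurable_prodMk_of_borelSpace _) hW.measurableSet]
  exact (hν.lowerSemicontinuous_section hW).measurable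

theorem IsTauAdditive.measurable_measure_section {ν : Measure Y} [IsProbabilityMeasure ν]
    (hν : IsTauAdditive ν) {W : Set (X × Y)} (hW : MeasurableSet W) :
    Measurable fun x : X => ν (Prod.mk x ⁻¹' W) := by
  simpa only [Function.comp_def, Measure.map_apply (measurable_prodMk_of_borelSpace _) hW] using
    (Measure.measurable_coe hW).comp hν.measurable_map_prodMk

/-- The measure on the Borel sets of a product obtained by integrating the measures of the
vertical sections. -/
noncomputable def sectionMeasure (μ : Measure X) (ν : Measure Y) : Measure (X × Y) :=
  μ.bind fun x => ν.map (Prod.mk x)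

theorem sectionMeasure_apply (μ : Measure X) {ν : Measure Y} [IsProbabilityMeasure ν]
    (hν : IsTauAdditive ν) {W : Set (X × Y)} (hW : MeasurableSet W) :
    sectionMeasure μ ν W = ∫⁻ x, ν (Prod.mk x ⁻¹' W) ∂μ := by
  rw [sectionMeasure, Measure.bind_apply hW hν.measurable_map_prodMk.aemeasurable]
  simp only [Measure.map_apply (measurable_prodMk_of_borelSpace _) hW]

theorem sectionMeasure_prod (μ : Measure X) {ν : Measure Y} [IsProbabilityMeasure ν]
    (hν : IsTauAdditive ν) {U : Set X} {V : Set Y} (hU : IsOpen U) (hV : IsOpen V) :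
    sectionMeasure μ ν (U ×ˢ V) = μ U * ν V := by
  classical
  rw [sectionMeasure_apply μ hν (hU.prod hV).measurableSet]
  have : (fun x => ν (Prod.mk x ⁻¹' U ×ˢ V)) = U.indicator fun _ => ν V := by
    ext x
    by_cases hx : x ∈ U <;> simp [hx]
  rw [this, lintegral_indicator_const hU.measurableSet, mul_comm]

/-- Exceptional null sets may depend on the level `q`; restricting to rational levels leaves
countably many, and still determines the section measures almost everywhere. -/
theorem isTauAdditive_sectionMeasure {μ : Measure X} [IsFiniteMeasure μ] (hμ : IsTauAdditive μ)
    {ν : Measure Y} [IsProbabilityMeasure ν] (hν : IsTauAdditive ν) :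
    IsTauAdditive (sectionMeasure μ ν) := by
  refine IsTauAdditive.of_exists_countable fun 𝒢 hne hdir hopen => ?_
  let S : ℚ → Set (X × Y) → Set X := fun q G => {x | ENNReal.ofReal q < ν (Prod.mk x ⁻¹' G)}
  have hSmono : ∀ q, Monotone (S q) := fun q G H hGH x (hx : _ < _) =>
    hx.trans_le (measure_mono (Set.preimage_mono hGH))
  have hSopen : ∀ q G, IsOpen G → IsOpen (S q G) := fun q G hG =>
    (hν.lowerSemicontinuous_section hG).isOpen_preimage _
  have hSunion : ∀ q, S q (⋃₀ 𝒢) ⊆ ⋃₀ (S q '' 𝒢) := by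
    intro q x hx
    have hsec : Prod.mk x ⁻¹' ⋃₀ 𝒢 = ⋃₀ ((Prod.mk x ⁻¹' ·) '' 𝒢) := by
      rw [Set.sUnion_image, Set.preimage_sUnion]
    have hopen' : ∀ V ∈ (Prod.mk x ⁻¹' · : Set (X × Y) → Set Y) '' 𝒢, IsOpen V := by
      rintro _ ⟨G, hG, rfl⟩
      exact (hopen G hG).preimage (by fun_prop)
    have hx : ENNReal.ofReal q < ν (Prod.mk x ⁻¹' ⋃₀ 𝒢) := hx
    rw [hsec, hν _ (hne.image _) (hdir.image_of_monotone fun _ _ h => Set.preimage_mono h) hopen'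
      (fun V hV => (hopen' V hV).measurableSet) (isOpen_sUnion hopen').measurableSet,
      iSup_image] at hx
    simp only [lt_iSup_iff] at hx
    obtain ⟨G, hG, hlt⟩ := hx
    exact ⟨_, ⟨G, hG, rfl⟩, hlt⟩
  have hcount : ∀ q, ∃ C ⊆ 𝒢, C.Countable ∧ μ (S q (⋃₀ 𝒢) \ S q (⋃₀ C)) = 0 := by
    intro q
    obtain ⟨C, hC, hCc, hCeq⟩ := hμ.exists_countable_measure_sUnion_image_eq hne hdir
      (hSmono q) fun G hG => hSopen q G (hopen G hG)
    refine ⟨C, hC, hCc, measure_mono_null (Set.sdiff_subset_sdiff (hSunion q)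
      (Set.sUnion_subset (S := S q '' C) ?_)) ?_⟩
    · rintro _ ⟨G, hG, rfl⟩
      exact hSmono q (Set.subset_sUnion_of_mem hG)
    · rw [measure_sdiff (Set.sUnion_subset_sUnion (Set.image_mono hC))
        (isOpen_sUnion (Set.forall_mem_image.2 fun G hG =>
          hSopen q G (hopen G (hC hG)))).measurableSet.nullMeasurableSet
        (measure_ne_top _ _), hCeq, tsub_self]
  choose C hC hCc hCnull using hcount
  refine ⟨⋃ q, C q, Set.iUnion_subset hC, Set.countable_iUnion hCc, ?_⟩
  have hCopen : IsOpen (⋃₀ ⋃ q, C q) :=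
    isOpen_sUnion fun G hG => hopen G (Set.iUnion_subset hC hG)
  rw [sectionMeasure_apply μ hν (isOpen_sUnion hopen).measurableSet,
    sectionMeasure_apply μ hν hCopen.measurableSet]
  refine lintegral_mono_ae ?_
  filter_upwards [ae_all_iff.2 fun q => measure_eq_zero_iff_ae_notMem.1 (hCnull q)] with x hx
  refine le_of_forall_lt fun r hr => ?_
  obtain ⟨q, -, hrq, hq⟩ := ENNReal.lt_iff_exists_rat_btwn.1 hr
  have : x ∈ S q (⋃₀ C q) := by
    by_contra hmem
    exact hx q ⟨hq, hmem⟩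
  exact hrq.trans (hSmono q (Set.sUnion_subset_sUnion (Set.subset_iUnion C q)) this)

end Sections

/-! ### Uniqueness on Borel sets and of the σ-algebra. -/

section Uniqueness

variable {X Y : Type*} [TopologicalSpace X] [TopologicalSpace Y]

/-- A finite `τ`-additive Borel measure on a product is determined by its values on open
rectangles. -/
theorem IsTauAdditive.ext_of_prod {m : MeasurableSpace (X × Y)} [BorelSpace (X × Y)]
    {lam₁ lam₂ : Measure (X × Y)} [IsFiniteMeasure lam₁]
    (h₁ : IsTauAdditive lam₁) (h₂ : IsTauAdditive lam₂)
    (h : ∀ (U : Set X) (V : Set Y), IsOpen U → IsOpen V → lam₁ (U ×ˢ V) = lam₂ (U ×ˢ V)) :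
    lam₁ = lam₂ := by
  have huniv : lam₁ Set.univ = lam₂ Set.univ := by
    simpa using h Set.univ Set.univ isOpen_univ isOpen_univ
  let R : Set (Set (X × Y)) := {s | ∃ U V, IsOpen U ∧ IsOpen V ∧ s = U ×ˢ V}
  have hRopen : ∀ s ∈ R, IsOpen s := by
    rintro _ ⟨U, V, hU, hV, rfl⟩
    exact hU.prod hV
  have hRpi : IsPiSystem R := by
    rintro _ ⟨U₁, V₁, hU₁, hV₁, rfl⟩ _ ⟨U₂, V₂, hU₂, hV₂, rfl⟩ -
    exact ⟨_, _, hU₁.inter hU₂, hV₁.inter hV₂, Set.prod_inter_prod⟩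
  have hgen : ∀ s, MeasurableSet[MeasurableSpace.generateFrom R] s → lam₁ s = lam₂ s := by
    intro s hs
    refine ext_on_measurableSpace_of_generate_finite m R ?_
      (MeasurableSpace.generateFrom_le fun s hs => (hRopen s hs).measurableSet) rfl hRpi huniv hs
    rintro _ ⟨U, V, hU, hV, rfl⟩
    exact h U V hU hV
  refine ext_of_generate_finite {s | IsOpen s} BorelSpace.measurable_eq isPiSystem_isOpen
    (fun W hW => ?_) huniv
  have hW : IsOpen W := hW
  -- Rectangles inside `W` are not directed; this larger family is, and the two measures already
  -- agree on it.
  let 𝒢 : Set (Set (X × Y)) :=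
    {G | IsOpen G ∧ MeasurableSet[MeasurableSpace.generateFrom R] G ∧ G ⊆ W}
  have hopen : ∀ G ∈ 𝒢, IsOpen G := fun G hG => hG.1
  have hne : 𝒢.Nonempty := ⟨∅, isOpen_empty, @MeasurableSet.empty _ (.generateFrom R),
    Set.empty_subset _⟩
  have hdir : DirectedOn (· ⊆ ·) 𝒢 := fun G hG H hH =>
    ⟨G ∪ H, ⟨hG.1.union hH.1, MeasurableSet.union hG.2.1 hH.2.1, Set.union_subset hG.2.2 hH.2.2⟩,
      Set.subset_union_left, Set.subset_union_right⟩
  have hunion : ⋃₀ 𝒢 = W := by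
    refine Set.Subset.antisymm (Set.sUnion_subset fun G hG => hG.2.2) ?_
    rintro ⟨x, y⟩ hxy
    obtain ⟨U, V, hU, hV, hx, hy, hsub⟩ := isOpen_prod_iff.1 hW x y hxy
    exact ⟨U ×ˢ V, ⟨hU.prod hV, MeasurableSpace.measurableSet_generateFrom ⟨U, V, hU, hV, rfl⟩,
      hsub⟩, hx, hy⟩
  have e₁ := h₁ 𝒢 hne hdir hopen (fun G hG => hG.1.measurableSet)
    (isOpen_sUnion hopen).measurableSet
  have e₂ := h₂ 𝒢 hne hdir hopen (fun G hG => hG.1.measurableSet)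
    (isOpen_sUnion hopen).measurableSet
  rw [hunion] at e₁ e₂
  rw [e₁, e₂]
  exact biSup_congr fun G hG => hgen G hG.2.1

/-- The supremum is attained by the union of a sequence of approximating subsets. -/
theorem MeasureTheory.Measure.InnerRegularWRT.exists_subset_measure_eq {Z : Type*}
    {m₀ m : MeasurableSpace Z} {lam : @Measure Z m}
    (h : @Measure.InnerRegularWRT Z m lam (fun B => MeasurableSet[m₀] B)
      fun E => MeasurableSet[m] E) {E : Set Z} (hE : MeasurableSet[m] E) :
    ∃ B ⊆ E, MeasurableSet[m₀] B ∧ lam B = lam E := by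
  rcases eq_or_ne (lam E) 0 with h0 | h0
  · exact ⟨∅, Set.empty_subset _, @MeasurableSet.empty _ m₀, by simp [h0]⟩
  obtain ⟨u, -, hu, hlim⟩ := exists_seq_strictMono_tendsto' (pos_iff_ne_zero.2 h0)
  choose B hBE hB hlt using fun n => h hE (u n) (hu n).2
  refine ⟨⋃ n, B n, Set.iUnion_subset hBE, MeasurableSet.iUnion hB,
    le_antisymm (measure_mono (Set.iUnion_subset hBE)) (le_of_tendsto' hlim fun n => ?_)⟩
  exact (hlt n).le.trans (measure_mono (Set.subset_iUnion B n))

/-- Of two measures which agree on a `σ`-algebra `m₀`, the first finite and inner regular with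
respect to `m₀` and the second complete, the second extends the first. -/
theorem MeasureTheory.Measure.InnerRegularWRT.measurableSet_and_measure_eq {Z : Type*}
    {m₀ m₁ m₂ : MeasurableSpace Z} {lam₁ : @Measure Z m₁} {lam₂ : @Measure Z m₂}
    (hfin : @IsFiniteMeasure Z m₁ lam₁) (hm₁ : m₀ ≤ m₁) (hm₂ : m₀ ≤ m₂)
    (h₁ : @Measure.InnerRegularWRT Z m₁ lam₁ (fun B => MeasurableSet[m₀] B)
      fun E => MeasurableSet[m₁] E)
    (h₂ : @Measure.IsComplete Z m₂ lam₂)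
    (heq : ∀ B, MeasurableSet[m₀] B → lam₁ B = lam₂ B) {E : Set Z} (hE : MeasurableSet[m₁] E) :
    MeasurableSet[m₂] E ∧ lam₁ E = lam₂ E := by
  obtain ⟨B, hBE, hB, hBeq⟩ := h₁.exists_subset_measure_eq hE
  obtain ⟨D, hDE, hD, hDeq⟩ := h₁.exists_subset_measure_eq (MeasurableSet.compl hE)
  -- `E` is squeezed between `B` and `Dᶜ`, both in `m₀`; once their difference is null for `lam₂`
  -- too, completeness applies.
  have hnull : lam₁ (Dᶜ \ B) = 0 := by
    rw [@measure_sdiff Z m₁ lam₁ _ _ (hBE.trans (Set.subset_compl_comm.1 hDE))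
      (hm₁ _ hB).nullMeasurableSet (measure_ne_top _ _), @measure_compl Z m₁ lam₁ _ (hm₁ _ hD)
      (measure_ne_top _ _), hDeq, @measure_compl Z m₁ lam₁ _ hE (measure_ne_top _ _), hBeq,
      ENNReal.sub_sub_cancel (measure_ne_top _ _) (measure_mono (Set.subset_univ _)), tsub_self]
  rw [heq _ (MeasurableSet.diff (MeasurableSet.compl hD) hB)] at hnull
  have hnull' : lam₂ (E \ B) = 0 :=
    measure_mono_null (Set.sdiff_subset_sdiff_left (Set.subset_compl_comm.1 hDE)) hnull
  have hEB : B ∪ E \ B = E := Set.union_sdiff_cancel hBE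
  refine ⟨hEB ▸ MeasurableSet.union (hm₂ _ hB) (h₂.out' _ hnull'), ?_⟩
  rw [← hBeq, heq B hB]
  refine le_antisymm (measure_mono hBE) ?_
  calc lam₂ E = lam₂ (B ∪ E \ B) := by rw [hEB]
    _ ≤ lam₂ B + lam₂ (E \ B) := measure_union_le _ _
    _ = lam₂ B := by rw [hnull', add_zero]

end Uniqueness

/-! ### Comparison with the completed Borel measure. -/

section Product

variable {X Y : Type*} [TopologicalSpace X] [MeasurableSpace X]
  [TopologicalSpace Y] [MeasurableSpace Y]

theorem isTauAdditive_trim {Z : Type*} [TopologicalSpace Z] {m₀ m : MeasurableSpace Z}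
    (hm : m₀ ≤ m) {lam : @Measure Z m} (h : @IsTauAdditive Z _ m lam) :
    @IsTauAdditive Z _ m₀ (lam.trim hm) := by
  intro 𝒢 hne hdir hopen hmeas hU
  rw [trim_measurableSet_eq hm hU, h 𝒢 hne hdir hopen (fun G hG => hm _ (hmeas G hG)) (hm _ hU)]
  exact biSup_congr fun G hG => (trim_measurableSet_eq hm (hmeas G hG)).symm

theorem IsTauProduct.measure_univ {μ : Measure X} [IsProbabilityMeasure μ] {ν : Measure Y}
    [IsProbabilityMeasure ν] {m : MeasurableSpace (X × Y)} {lam : @Measure (X × Y) m}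
    (h : IsTauProduct μ ν lam) : lam Set.univ = 1 := by
  simpa using h.rectangle Set.univ Set.univ isOpen_univ isOpen_univ

theorem IsTauProduct.isFiniteMeasure {μ : Measure X} [IsProbabilityMeasure μ] {ν : Measure Y}
    [IsProbabilityMeasure ν] {m : MeasurableSpace (X × Y)} {lam : @Measure (X × Y) m}
    (h : IsTauProduct μ ν lam) : @IsFiniteMeasure _ m lam :=
  ⟨by rw [h.measure_univ]; exact ENNReal.one_lt_top⟩

/-- A `τ`-additive product extends every finite `τ`-additive Borel measure with the right values
on open rectangles. -/
theorem IsTauProduct.apply_eq {μ : Measure X} [IsProbabilityMeasure μ] {ν : Measure Y}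
    [IsProbabilityMeasure ν] {m m₀ : MeasurableSpace (X × Y)} [BorelSpace (X × Y)]
    {lam : @Measure (X × Y) m} (h : IsTauProduct μ ν lam)
    {lam₀ : @Measure (X × Y) m₀} (h₀ : @IsTauAdditive _ _ m₀ lam₀)
    (hrect : ∀ (U : Set X) (V : Set Y), IsOpen U → IsOpen V → lam₀ (U ×ˢ V) = μ U * ν V)
    {W : Set (X × Y)} (hW : MeasurableSet[m₀] W) : lam W = lam₀ W := by
  have hle : m₀ ≤ m := (BorelSpace.measurable_eq (α := X × Y)).le.trans h.topological
  have := h.isFiniteMeasure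
  have : @IsFiniteMeasure _ m₀ (lam.trim hle) := isFiniteMeasure_trim hle
  rw [← trim_measurableSet_eq hle hW]
  congr 1
  refine IsTauAdditive.ext_of_prod
    (isTauAdditive_trim hle h.tauAdditive) h₀
    fun U V hU hV => ?_
  rw [trim_measurableSet_eq hle (hU.prod hV).measurableSet, h.rectangle U V hU hV,
    hrect U V hU hV]

/-- The completion of a finite `τ`-additive Borel measure with the right values on open rectangles
is a `τ`-additive product. -/
theorem isTauProduct_completion {μ : Measure X} {ν : Measure Y} {m₀ : MeasurableSpace (X × Y)}
    [BorelSpace (X × Y)] {lam₀ : Measure (X × Y)} [IsFiniteMeasure lam₀]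
    (h₀ : IsTauAdditive lam₀)
    (hrect : ∀ (U : Set X) (V : Set Y), IsOpen U → IsOpen V → lam₀ (U ×ˢ V) = μ U * ν V) :
    @IsTauProduct X Y _ _ _ _ μ ν
      (NullMeasurableSpace.instMeasurableSpace (α := X × Y) (μ := lam₀)) lam₀.completion := by
  refine @IsTauProduct.mk X Y _ _ _ _ μ ν
    (NullMeasurableSpace.instMeasurableSpace (α := X × Y) (μ := lam₀)) lam₀.completion
    ?_ ?_ ?_ ?_ ?_ ?_ ?_
  · intro s hs
    rw [← BorelSpace.measurable_eq (α := X × Y)] at hs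
    exact hs.nullMeasurableSet
  · exact Measure.completion.isComplete lam₀
  · refine @IsLocallyDetermined.mk (X × Y) _ _ (fun E _ hE => ?_) fun E hE => ?_
    · exact absurd hE (measure_ne_top lam₀ E)
    · have := hE Set.univ (@MeasurableSet.univ _ _) (measure_lt_top lam₀ _)
      rwa [Set.inter_univ] at this
  · intro E _ hE
    exact ⟨Set.univ, isOpen_univ, @MeasurableSet.univ _ _, measure_lt_top lam₀ _,
      by rwa [Set.inter_univ]⟩
  · intro 𝒢 hne hdir hopen _ _
    exact h₀ 𝒢 hne hdir hopen (fun G hG => (hopen G hG).measurableSet)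
      (isOpen_sUnion hopen).measurableSet
  · intro E hE r hr
    obtain ⟨B, hBE, hB, hBeq⟩ := NullMeasurableSet.exists_measurable_subset_ae_eq (μ := lam₀) hE
    refine ⟨B, hBE, ?_, hr.trans_eq (measure_congr hBeq).symm⟩
    rwa [← BorelSpace.measurable_eq (α := X × Y)]
  · exact hrect

theorem IsTauProduct.sigma_eq {μ : Measure X} [IsProbabilityMeasure μ] {ν : Measure Y}
    [IsProbabilityMeasure ν] {P Q : Σ m : MeasurableSpace (X × Y), @Measure (X × Y) m}
    (hP : IsTauProduct μ ν P.2) (hQ : IsTauProduct μ ν Q.2)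
    (h : ∀ B, MeasurableSet[borel (X × Y)] B → P.2 B = Q.2 B) : P = Q := by
  obtain ⟨m₁, lam₁⟩ := P
  obtain ⟨m₂, lam₂⟩ := Q
  have key₁ := fun E => hP.innerRegular_borel.measurableSet_and_measure_eq hP.isFiniteMeasure
    hP.topological hQ.topological hQ.complete h (E := E)
  have key₂ := fun E => hQ.innerRegular_borel.measurableSet_and_measure_eq hQ.isFiniteMeasure
    hQ.topological hP.topological hP.complete (fun B hB => (h B hB).symm) (E := E)
  obtain rfl : m₁ = m₂ := le_antisymm (fun E hE => (key₁ E hE).1) fun E hE => (key₂ E hE).1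
  obtain rfl : lam₁ = lam₂ := Measure.ext fun E hE => (key₁ E hE).2
  rfl

end Product

theorem mainTheorem5 {X Y : Type*}
    [TopologicalSpace X] [RegularSpace X] [MeasurableSpace X] [BorelSpace X]
    [TopologicalSpace Y] [RegularSpace Y] [MeasurableSpace Y] [BorelSpace Y]
    (μ : Measure X) [IsProbabilityMeasure μ] (hμ : IsTauAdditive μ)
    (ν : Measure Y) [IsProbabilityMeasure ν] (hν : IsTauAdditive ν) :
    (∃! P : (Σ m : MeasurableSpace (X × Y), @Measure (X × Y) m), IsTauProduct μ ν P.2) ∧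
    ∀ (m : MeasurableSpace (X × Y)) (lam : @Measure (X × Y) m), IsTauProduct μ ν lam →
      ∀ W : Set (X × Y), MeasurableSet[borel (X × Y)] W →
        Measurable (fun x : X => ν {y : Y | (x, y) ∈ W}) ∧
        Measurable (fun y : Y => μ {x : X | (x, y) ∈ W}) ∧
        lam W = ∫⁻ x, ν {y : Y | (x, y) ∈ W} ∂μ ∧
        lam W = ∫⁻ y, μ {x : X | (x, y) ∈ W} ∂ν := by
  let mXY : MeasurableSpace (X × Y) := borel (X × Y)
  have : BorelSpace (X × Y) := ⟨rfl⟩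
  let mYX : MeasurableSpace (Y × X) := borel (Y × X)
  have : BorelSpace (Y × X) := ⟨rfl⟩
  have hswap : Measurable (Prod.swap : Y × X → X × Y) := continuous_swap.measurable
  have hτ := isTauAdditive_sectionMeasure hμ hν
  have hrect := fun (U : Set X) (V : Set Y) (hU : IsOpen U) (hV : IsOpen V) =>
    sectionMeasure_prod μ hν hU hV
  -- The other order of integration, carried back by the swap; `IsTauProduct.apply_eq` applies to it
  -- as well.
  have hτ' := isTauAdditive_map (isTauAdditive_sectionMeasure hν hμ) continuous_swap
  have hrect' : ∀ (U : Set X) (V : Set Y), IsOpen U → IsOpen V →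
      (sectionMeasure ν μ).map Prod.swap (U ×ˢ V) = μ U * ν V := fun U V hU hV => by
    rw [Measure.map_apply hswap (hU.prod hV).measurableSet, Set.preimage_swap_prod,
      sectionMeasure_prod ν hμ hV hU, mul_comm]
  have : IsFiniteMeasure (sectionMeasure μ ν) := ⟨by
    rw [← Set.univ_prod_univ, hrect _ _ isOpen_univ isOpen_univ]
    simp⟩
  have hint : ∀ W : Set (X × Y), MeasurableSet W →
      Measurable (fun x : X => ν {y : Y | (x, y) ∈ W}) ∧
      Measurable (fun y : Y => μ {x : X | (x, y) ∈ W}) ∧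
      sectionMeasure μ ν W = ∫⁻ x, ν {y : Y | (x, y) ∈ W} ∂μ ∧
      (sectionMeasure ν μ).map Prod.swap W = ∫⁻ y, μ {x : X | (x, y) ∈ W} ∂ν := fun W hW => by
    refine ⟨hν.measurable_measure_section hW, hμ.measurable_measure_section (hswap hW),
      sectionMeasure_apply μ hν hW, ?_⟩
    rw [Measure.map_apply hswap hW, sectionMeasure_apply ν hμ (hswap hW)]
    rfl
  refine ⟨⟨⟨_, _⟩, isTauProduct_completion hτ hrect, fun P hP => ?_⟩, fun m lam h W hW => ?_⟩
  · exact hP.sigma_eq (isTauProduct_completion hτ hrect) fun B hB => hP.apply_eq hτ hrect hB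
  · obtain ⟨h₁, h₂, h₃, h₄⟩ := hint W hW
    exact ⟨h₁, h₂, (h.apply_eq (m₀ := mXY) hτ hrect hW).trans h₃,
      (h.apply_eq (m₀ := mXY) hτ' hrect' hW).trans h₄⟩
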